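/- Let $0<\delta\le 1$. For $n'\in\mathbb N$ put $t=\lfloor(\log n')^{1-\delta}\rfloor$ (natural logarithm) and $n=\lfloor n'/t\rfloor\,t$, and let $N=\{1,\dots,n\}$. Consider the Min-Knapsack linear program with knapsack cover inequalities for $n$ items of unit cost and unit profit and demand $1+\frac1{n-1}$: $$(LP^+)\quad \min\sum_{j\in N}x_j\quad\text{s.t.}\quad \sum_{j\in N}x_j\ge 1+\tfrac1{n-1},\qquad \sum_{j\in N'}x_j\ge 1\ \ (N'\subseteq N,\ |N'|=n-1),\qquad 0\le x_j\le 1\ (j\in N).$$ For linear constraints $g_\ell(x)\ge0$ (here those of $LP^+$, including the box constraints), the $t$-th round SoS relaxation $\mathrm{SoS}_t$ is the set of all real vectors $(y_I)_{I\subseteq N}$ such that $\sum_I y_I=1$, $\sum_I y_I Z_IZ_I^\top\succeq0$ with $Z_I\in\{0,1\}^{\{J\subseteq N:|J|\le t+1\}}$, and, for every $\ell$, $\sum_I g_\ell(x_I)\,y_I Z_IZ_I^\top\succeq0$ with $Z_I\in\{0,1\}^{\{J\subseteq N:|J|\le t\}}$. Here $x_I$ is the $0/1$ indicator vector of $I$,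 and $(Z_I)_J=1$ if and only if $J\subseteq I$. The objective value of $(y_I)$ is $\sum_I y_I|I|$. Then there is a sequence $\epsilon=\epsilon(n')$, positive for all sufficiently large $n'$ and with $\epsilon=o(1/t)$ as $n'\to\infty$, such that for all sufficiently large $n'$ the vector $$y_I=\binom{n}{|I|}^{-1}\cdot\begin{cases}\dfrac{(1+\epsilon)n}{(n-1)\lfloor\log n\rfloor}&|I|=\lfloor\log n\rfloor,\\[2mm] \dfrac{\epsilon t}{jn}&|I|=j\frac nt,\ j\in\{1,\dots,t\},\\[2mm] 1-\sum_{\emptyset\ne J\subseteq N}y_J&I=\emptyset,\\ 0&\text{otherwise}\end{cases}$$ belongs to $\mathrm{SoS}_t(LP^+)$. As $n'\to\infty$, $y_\emptyset\to1$ and the objective value of $(y_I)$ tends to $1$, while for all sufficiently large $n'$ the optimal value of $LP^+$ over $0/1$ points is $2$. The integrality gap of $\mathrm{SoS}_t(LP^+)$ (the integral optimum divided by the infimum of the objective over $\mathrm{SoS}_t(LP^+)$) is defined for all sufficiently large $n'$ and equals $2-o(1)$, i.e. it tends to $2$. -/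

import Mathlib

open Filter Topology Asymptotics

noncomputable section

namespace SoSKnapsack

/-- The linear constraint `∑ i, coeff i * x i - rhs ≥ 0` in `n` real variables. -/
structure LinConstraint (n : ℕ) where
  coeff : Fin n → ℝ
  rhs : ℝ

/-- The value `g(x)` of the constraint `g(x) ≥ 0` at the point `x`. -/
def LinConstraint.eval {n : ℕ} (g : LinConstraint n) (x : Fin n → ℝ) : ℝ :=
  ∑ i, g.coeff i * x i - g.rhs

/-- The `0/1` point `x_I`: it is `1` on `I` and `0` off `I`. -/
def point {n : ℕ} (I : Finset (Fin n)) : Fin n → ℝ :=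
  fun i => if i ∈ I then 1 else 0

/-- The subsets of `{1, …, n}` of size at most `q`. -/
abbrev SmallSets (n q : ℕ) : Type := {J : Finset (Fin n) // J.card ≤ q}

/-- The `q`-zeta vector `Z_I`: its `J`-th entry is `1` if `J ⊆ I` and `0` otherwise. -/
def zeta {n : ℕ} (q : ℕ) (I : Finset (Fin n)) : SmallSets n q → ℝ :=
  fun J => if J.1 ⊆ I then 1 else 0

/-- The matrix `∑ I, z I • Z_I Z_Iᵀ`, indexed by the sets of size at most `q`. -/
def zetaMatrix {n : ℕ} (q : ℕ) (z : Finset (Fin n) → ℝ) :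
    Matrix (SmallSets n q) (SmallSets n q) ℝ :=
  ∑ I : Finset (Fin n), z I • Matrix.vecMulVec (zeta q I) (zeta q I)

open Classical in
/-- The `t`-th round SoS relaxation of the `0/1` problem with linear constraints `g l ≥ 0`,
`l : ι`: the set of all `y = (y_I)` such that the `y_I` sum to one, the moment matrix (of order
`t + d`, where `d = 0` if there are no constraints and `d = 1` otherwise) is positive semidefinite
and the localizing matrix (of order `t`) of every constraint is positive semidefinite. -/
def SoS {n : ℕ} {ι : Type} (t : ℕ) (g : ι → LinConstraint n) : Set (Finset (Fin n) → ℝ) :=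
  {y | ∑ I : Finset (Fin n), y I = 1 ∧
    (zetaMatrix (t + if IsEmpty ι then 0 else 1) y).PosSemidef ∧
    ∀ l : ι, (zetaMatrix t fun I => (g l).eval (point I) * y I).PosSemidef}

/-- The objective value of `y` for the cost vector `c`: each `x_I` has cost `∑ i, c i * x_I i`. -/
def objective {n : ℕ} (c : Fin n → ℝ) (y : Finset (Fin n) → ℝ) : ℝ :=
  ∑ I : Finset (Fin n), y I * ∑ i, c i * point I i

/-- The costs of the integral (`0/1`) points that satisfy all the constraints. -/
def integralValues {n : ℕ} {ι : Type} (c : Fin n → ℝ) (g : ι → LinConstraint n) : Set ℝ :=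
  {v | ∃ I : Finset (Fin n), (∀ l, 0 ≤ (g l).eval (point I)) ∧ v = ∑ i, c i * point I i}

/-- `ρ` is the integrality gap of the `t`-th round SoS relaxation of the minimization problem with
costs `c` and constraints `g`: the integral optimum divided by the optimal value (the infimum) of
the relaxation. -/
def IsIntegralityGap {n : ℕ} {ι : Type} (t : ℕ) (c : Fin n → ℝ) (g : ι → LinConstraint n)
    (ρ : ℝ) : Prop :=
  ∃ opt val : ℝ, IsLeast (integralValues c g) opt ∧ IsGLB (objective c '' SoS t g) val ∧
    0 < val ∧ ρ = opt / val

/-- Indices of the constraints of the strengthened Min-Knapsack linear program. -/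
inductive KCIndex (n : ℕ) : Type
  | demand : KCIndex n
  | cover (A : Finset (Fin n)) (hA : A.card = n - 1) : KCIndex n
  | nonneg (i : Fin n) : KCIndex n
  | le_one (i : Fin n) : KCIndex n

/-- The Min-Knapsack linear program with knapsack cover inequalities, for `n` items of unit profit
and demand `1 + 1/(n-1)`:
`∑ j, x j ≥ 1 + 1/(n-1)`, `∑ j ∈ A, x j ≥ 1` for every `A` of size `n - 1`, and `0 ≤ x i ≤ 1`. -/
def lpPlus (n : ℕ) : KCIndex n → LinConstraint n
  | .demand => ⟨fun _ => 1, 1 + 1 / ((n : ℝ) - 1)⟩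
  | .cover A _ => ⟨fun j => if j ∈ A then 1 else 0, 1⟩
  | .nonneg i => ⟨fun j => if j = i then 1 else 0, 0⟩
  | .le_one i => ⟨fun j => if j = i then -1 else 0, -1⟩

/-- The unit costs of the items. -/
def unitCost (n : ℕ) : Fin n → ℝ := fun _ => 1

/-- The value of the symmetric solution on the nonempty sets `I`. The condition
`|I| * t = j * n` says that `|I| = j * (n / t)`; for `n, t > 0` at most one `j` satisfies it. -/
def solutionNonempty (n t : ℕ) (ε : ℝ) (I : Finset (Fin n)) : ℝ :=
  ((n.choose I.card : ℕ) : ℝ)⁻¹ *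
    if I.card = ⌊Real.log n⌋₊ then (1 + ε) * n / (((n : ℝ) - 1) * (⌊Real.log n⌋₊ : ℝ))
    else ∑ j ∈ Finset.Icc 1 t, if I.card * t = j * n then ε * t / ((j : ℝ) * n) else 0

/-- The symmetric solution `(y_I)`: on the empty set it takes the value that makes the total mass
equal to one. -/
def solution (n t : ℕ) (ε : ℝ) (I : Finset (Fin n)) : ℝ :=
  if I = ∅ then 1 - ∑ J ∈ (Finset.univ : Finset (Finset (Fin n))).erase ∅, solutionNonempty n t ε J
  else solutionNonempty n t ε I

/-- The number of rounds `t = ⌊(log n')^(1-δ)⌋`, with the natural logarithm. -/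
def rounds (δ : ℝ) (n' : ℕ) : ℕ := ⌊Real.log n' ^ (1 - δ)⌋₊

/-- The number of items `n = ⌊n' / t⌋ * t`. -/
def items (δ : ℝ) (n' : ℕ) : ℕ := n' / rounds δ n' * rounds δ n'

end SoSKnapsack

end

/-!
The symmetric solution is nonnegative, so its moment matrix is positive semidefinite, and so is the
localizing matrix of every constraint that is nonnegative on the cube. The demand and cover
constraints are violated, among the points carrying mass, only on the empty set, by at most
`n / (n - 1)`. On all other sets `I` they are at least `|I| - 2`. Hence it suffices that every
polynomial `P` of degree at most `t` satisfies
`n / (n - 1) * P(∅)² ≤ ∑_{I ≠ ∅} (|I| - 2) y_I P(x_I)²`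
(`posSemidef_localizing`).

The right-hand side is symmetric, so `P` may be replaced by its averages over the levels of the cube
(`sum_levels_mul_sq_le`): by the Cauchy–Schwarz inequality this decreases the right-hand side, and
the average over the `k`-sets is the value at `k` of a univariate polynomial `p` of degree at most
`t` (`levelAverage`). The mass of the solution sits on the `t + 1` levels `L = ⌊log n⌋` and `j m`,
where `m = n / t` and `1 ≤ j ≤ t`, so `p(0)` is determined by the values of `p` there. As `L ≪ m`,
Lagrange interpolation expresses `p(0)` with a weight `1 + O(t L / m)` on `p(L)` and weights
`O(2^t L / m)` on the `p(j m)` (`sq_eval_zero_le`). The level `L` contributes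
`(1 + ε) (1 - 2 / L) n / (n - 1)` to the right-hand side, which exceeds `(1 + 1 / L) n / (n - 1)` for
`ε = 4 / L`, and the levels `j m` contribute at least `ε / 2` each, far more than the tiny weights
need, because `4^t ≤ 4^L ≤ n^{3/2}`. This proves feasibility (`solution_mem_SoS`).

The choice `ε = 4 / L` is `o(1 / t)` since `t ≤ (log n')^(1 - δ)`. The objective of the solution is
`(1 + ε) n / (n - 1) + t ε → 1`, while the demand constraint forces every feasible vector to have
objective at least `1`. An integral solution needs two items, so the gap tends to `2`.
-/

noncomputable section

namespace SoSKnapsack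

open Finset Polynomial Matrix

/-! ### Moment matrices as sums of squares -/

lemma isHermitian_zetaMatrix {n : ℕ} (q : ℕ) (z : Finset (Fin n) → ℝ) :
    (zetaMatrix q z).IsHermitian := by
  ext J K
  simp only [zetaMatrix, conjTranspose_apply, star_trivial, Matrix.sum_apply, Matrix.smul_apply,
    vecMulVec_apply]
  exact sum_congr rfl fun I _ => by rw [mul_comm (zeta q I K)]

lemma dotProduct_zetaMatrix_mulVec {n : ℕ} (q : ℕ) (z : Finset (Fin n) → ℝ)
    (v : SmallSets n q → ℝ) :
    v ⬝ᵥ (zetaMatrix q z *ᵥ v) = ∑ I, z I * (v ⬝ᵥ zeta q I) ^ 2 := by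
  rw [zetaMatrix, sum_mulVec, dotProduct_sum]
  refine sum_congr rfl fun I _ => ?_
  rw [smul_mulVec, dotProduct_smul, vecMulVec_mulVec, dotProduct_smul, dotProduct_comm (zeta q I)]
  simp only [MulOpposite.smul_eq_mul_unop, MulOpposite.unop_op, smul_eq_mul, sq]

/-- A matrix `∑ z_I Z_I Z_Iᵀ` is positive semidefinite iff the functional `p ↦ ∑ z_I p(x_I)` is
nonnegative on the squares of polynomials of degree at most `q`; here `v ⬝ᵥ zeta q I` is the value
at `x_I` of the multilinear polynomial with coefficients `v`. -/
lemma posSemidef_zetaMatrix_iff {n : ℕ} (q : ℕ) (z : Finset (Fin n) → ℝ) :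
    (zetaMatrix q z).PosSemidef ↔
      ∀ v : SmallSets n q → ℝ, 0 ≤ ∑ I, z I * (v ⬝ᵥ zeta q I) ^ 2 := by
  rw [posSemidef_iff_dotProduct_mulVec]
  simp only [isHermitian_zetaMatrix, true_and, star_trivial, dotProduct_zetaMatrix_mulVec]

lemma posSemidef_zetaMatrix_of_nonneg {n : ℕ} (q : ℕ) {z : Finset (Fin n) → ℝ}
    (hz : ∀ I, 0 ≤ z I) : (zetaMatrix q z).PosSemidef :=
  (posSemidef_zetaMatrix_iff q z).2 fun _ =>
    sum_nonneg fun I _ => mul_nonneg (hz I) (sq_nonneg _)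

/-- Testing a moment or localizing matrix on the constant polynomial `1`. -/
lemma sum_nonneg_of_posSemidef_zetaMatrix {n : ℕ} {q : ℕ} {z : Finset (Fin n) → ℝ}
    (hz : (zetaMatrix q z).PosSemidef) : 0 ≤ ∑ I, z I := by
  have h := (posSemidef_zetaMatrix_iff q z).1 hz (Pi.single ⟨∅, by simp⟩ 1)
  simpa [zeta] using h

/-! ### Averaging a polynomial over a level of the cube -/

/-- The number of `k`-sets above `J` is `C(n, k) C(k, |J|) / C(n, |J|)`, a polynomial in `k` up to
the factor `C(n, k)`. -/
lemma card_superset_mul_choose {n : ℕ} (J : Finset (Fin n)) (k : ℕ) :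
    #((powersetCard k univ).filter (J ⊆ ·)) * n.choose #J = n.choose k * k.choose #J := by
  by_cases hk : #J ≤ k
  · rw [card_filter_powersetCard_subset J univ k (subset_univ J) hk, card_univ, Fintype.card_fin,
      Nat.choose_mul hk, mul_comm]
  · rw [Nat.choose_eq_zero_of_lt (not_le.1 hk), mul_zero, filter_eq_empty_iff.2, card_empty,
      zero_mul]
    intro I hI hJI
    exact hk ((card_le_card hJI).trans_eq (mem_powersetCard.1 hI).2)

/-- The univariate polynomial whose value at `k` is the average over all `k`-sets `I` of the values
at `x_I` of the multilinear polynomial with coefficients `v`. -/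
def levelAverage {n q : ℕ} (v : SmallSets n q → ℝ) : ℝ[X] :=
  ∑ J, C (v J / ((n.choose #J.1 : ℝ) * ((#J.1).factorial : ℝ))) * descPochhammer ℝ #J.1

lemma natDegree_levelAverage_le {n q : ℕ} (v : SmallSets n q → ℝ) :
    (levelAverage v).natDegree ≤ q := by
  refine natDegree_sum_le_of_forall_le _ _ fun J _ => ?_
  exact (natDegree_C_mul_le _ _).trans ((descPochhammer_natDegree ℝ _).trans_le J.2)

lemma eval_levelAverage {n q : ℕ} (v : SmallSets n q → ℝ) (k : ℕ) :
    (levelAverage v).eval (k : ℝ) = ∑ J, v J * (k.choose #J.1 / n.choose #J.1 : ℝ) := by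
  rw [levelAverage, eval_finsetSum]
  refine sum_congr rfl fun J _ => ?_
  have hf : ((#J.1).factorial : ℝ) ≠ 0 := by positivity
  rw [eval_C_mul, descPochhammer_eval_eq_descFactorial, Nat.descFactorial_eq_factorial_mul_choose,
    Nat.cast_mul]
  field_simp

lemma sum_level_dotProduct_zeta {n q : ℕ} (v : SmallSets n q → ℝ) (k : ℕ) :
    ∑ I ∈ powersetCard k univ, v ⬝ᵥ zeta q I = n.choose k * (levelAverage v).eval (k : ℝ) := by
  simp only [dotProduct]
  rw [sum_comm, eval_levelAverage, mul_sum]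
  refine sum_congr rfl fun J _ => ?_
  have hJ : (0 : ℝ) < n.choose #J.1 := by
    exact_mod_cast Nat.choose_pos ((card_le_univ J.1).trans_eq (Fintype.card_fin n))
  have h : (#((powersetCard k univ).filter (J.1 ⊆ ·)) : ℝ) * n.choose #J.1
      = n.choose k * k.choose #J.1 := by
    exact_mod_cast card_superset_mul_choose J.1 k
  rw [← mul_sum]
  simp only [zeta, sum_boole]
  field_simp
  linear_combination v J * h

lemma eval_zero_levelAverage {n q : ℕ} (v : SmallSets n q → ℝ) :
    (levelAverage v).eval 0 = v ⬝ᵥ zeta q ∅ := by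
  have h := sum_level_dotProduct_zeta v 0
  simpa using h.symm

/-- The average of the squares over a level is at least the square of the average. -/
lemma choose_mul_sq_eval_levelAverage_le {n q : ℕ} (v : SmallSets n q → ℝ) {k : ℕ} (hk : k ≤ n) :
    n.choose k * (levelAverage v).eval (k : ℝ) ^ 2
      ≤ ∑ I ∈ powersetCard k univ, (v ⬝ᵥ zeta q I) ^ 2 := by
  have hpos : (0 : ℝ) < n.choose k := by exact_mod_cast Nat.choose_pos hk
  have h := sq_sum_le_card_mul_sum_sq (s := powersetCard k (univ : Finset (Fin n)))
    (f := fun I => v ⬝ᵥ zeta q I)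
  rw [sum_level_dotProduct_zeta, card_powersetCard, card_univ, Fintype.card_fin] at h
  refine le_of_mul_le_mul_left ?_ hpos
  linarith

lemma sum_univ_eq_sum_levels {n : ℕ} (f : Finset (Fin n) → ℝ) :
    ∑ I, f I = ∑ k ∈ range (n + 1), ∑ I ∈ powersetCard k univ, f I := by
  rw [← powerset_univ, sum_powerset, card_univ, Fintype.card_fin]

/-- Under a symmetric measure, which gives mass `w k` to the level `k`, replacing a polynomial by its
level averages can only decrease the integral of its square. -/
lemma sum_levels_mul_sq_le {n q : ℕ} (v : SmallSets n q → ℝ) {w : ℕ → ℝ} (hw : ∀ k, 0 ≤ w k) :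
    ∑ k ∈ range (n + 1), w k * (levelAverage v).eval (k : ℝ) ^ 2
      ≤ ∑ I : Finset (Fin n), (n.choose #I : ℝ)⁻¹ * w #I * (v ⬝ᵥ zeta q I) ^ 2 := by
  rw [sum_univ_eq_sum_levels]
  refine sum_le_sum fun k hk => ?_
  have hk' : k ≤ n := Nat.lt_succ_iff.1 (mem_range.1 hk)
  have hpos : (0 : ℝ) < n.choose k := by exact_mod_cast Nat.choose_pos hk'
  have h := mul_le_mul_of_nonneg_left (choose_mul_sq_eval_levelAverage_le v hk')
    (mul_nonneg (inv_nonneg.2 hpos.le) (hw k))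
  refine le_trans (le_of_eq ?_) (h.trans_eq ?_)
  · field_simp
  · rw [mul_sum]
    refine sum_congr rfl fun I hI => ?_
    rw [(mem_powersetCard.1 hI).2]

/-! ### Interpolation at the nodes `L, m, 2m, …, tm` -/

lemma eval_basis_eq_prod {ι : Type*} [DecidableEq ι] (s : Finset ι) (x : ι → ℝ) (i : ι) (a : ℝ) :
    (Lagrange.basis s x i).eval a = ∏ j ∈ s.erase i, (a - x j) / (x i - x j) := by
  rw [Lagrange.basis, eval_prod]
  refine prod_congr rfl fun j _ => ?_
  rw [Lagrange.basisDivisor, eval_mul, eval_C, eval_sub, eval_X, eval_C, div_eq_inv_mul]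

/-- The absolute Lagrange weight at `0` of the node `j` among the nodes `1, …, t`. -/
lemma prod_abs_div_sub_eq_choose {j t : ℕ} (hj : 1 ≤ j) (hjt : j ≤ t) :
    ∏ i ∈ (Icc 1 t).erase j, |(i : ℝ) / ((j : ℝ) - i)| = t.choose j := by
  induction t, hjt using Nat.le_induction with
  | base =>
    have hIco : (Icc 1 j).erase j = Ico 1 j := by ext i; grind
    rw [hIco, Nat.choose_self, Nat.cast_one]
    simp only [abs_div]
    rw [prod_div_distrib, div_eq_one_iff_eq]
    · refine prod_nbij' (fun i => j - i) (fun i => j - i) ?_ ?_ ?_ ?_ ?_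
      · intro i hi; simp at hi ⊢; omega
      · intro i hi; simp at hi ⊢; omega
      · intro i hi; simp at hi ⊢; omega
      · intro i hi; simp at hi ⊢; omega
      · intro i hi
        rw [Nat.cast_sub (mem_Ico.1 hi).2.le, sub_sub_cancel]
    · refine prod_ne_zero_iff.2 fun i hi => abs_ne_zero.2 (sub_ne_zero.2 ?_)
      exact_mod_cast (mem_Ico.1 hi).2.ne'
  | succ t hjt ih =>
    have hins : (Icc 1 (t + 1)).erase j = insert (t + 1) ((Icc 1 t).erase j) := by
      ext i; simp; omega
    have hpos : (0 : ℝ) < (t : ℝ) + 1 - j := by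
      have : (j : ℝ) ≤ t := by exact_mod_cast hjt
      linarith
    have hc : (t.choose j : ℝ) * (t + 1) = (t + 1).choose j * ((t : ℝ) + 1 - j) := by
      have h := Nat.choose_mul_succ_eq t j
      have h' : ((t + 1 - j : ℕ) : ℝ) = (t : ℝ) + 1 - j := by
        rw [Nat.cast_sub (by omega)]; push_cast; ring
      rw [← h']
      exact_mod_cast h
    rw [hins, prod_insert (by simp), ih, abs_div, abs_sub_comm]
    push_cast
    rw [abs_of_pos hpos, abs_of_pos (by positivity : (0 : ℝ) < t + 1), div_mul_eq_mul_div,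
      div_eq_iff hpos.ne', ← hc]
    ring

/-- A weighted Cauchy–Schwarz inequality, in which the first coordinate has the weight `c`. -/
lemma sq_add_sum_mul_le {ι : Type*} (s : Finset ι) {a x c d : ℝ} (b y : ι → ℝ) {r : ℝ}
    (hr : 0 < r) (ha : (1 + r) * a ^ 2 ≤ c) (hb : (1 + r⁻¹) * ∑ i ∈ s, b i ^ 2 ≤ d) :
    (x * a + ∑ i ∈ s, y i * b i) ^ 2 ≤ c * x ^ 2 + d * ∑ i ∈ s, y i ^ 2 := by
  set S := ∑ i ∈ s, y i * b i
  have hS : S ^ 2 ≤ (∑ i ∈ s, y i ^ 2) * ∑ i ∈ s, b i ^ 2 := sum_mul_sq_le_sq_mul_sq s y b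
  have hY : 0 ≤ ∑ i ∈ s, y i ^ 2 := sum_nonneg fun i _ => sq_nonneg _
  have hr' : 0 < r⁻¹ := inv_pos.2 hr
  have h1 : (x * a + S) ^ 2 ≤ (1 + r) * (x * a) ^ 2 + (1 + r⁻¹) * S ^ 2 := by
    have : (1 + r) * (x * a) ^ 2 + (1 + r⁻¹) * S ^ 2 - (x * a + S) ^ 2
        = r * (x * a - r⁻¹ * S) ^ 2 := by
      field_simp
      ring
    nlinarith [mul_nonneg hr.le (sq_nonneg (x * a - r⁻¹ * S))]
  have h2 := mul_le_mul_of_nonneg_right ha (sq_nonneg x)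
  have h3 := mul_le_mul_of_nonneg_right hb hY
  have h4 := mul_le_mul_of_nonneg_left hS (by positivity : 0 ≤ 1 + r⁻¹)
  nlinarith

/-- A polynomial of degree at most `t` cannot be large at `0` without being almost as large at `L`
or rather large at one of the multiples of `m`: when `m` is much larger than `L` and `2 ^ t`, the
interpolation formula at `0` puts weight close to `1` on `L` and tiny weights elsewhere. -/
lemma sq_eval_zero_le {t L m : ℕ} (ht : 1 ≤ t) (hL : 1 ≤ L) (hm : 8 * t * L ^ 2 ≤ m)
    (hm' : 20 * t * L ^ 4 * 4 ^ t ≤ m ^ 2) (p : ℝ[X]) (hp : p.natDegree ≤ t) :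
    p.eval 0 ^ 2 ≤ (1 + 1 / (L : ℝ)) * p.eval (L : ℝ) ^ 2
      + 1 / (L : ℝ) * ∑ j ∈ Icc 1 t, p.eval ((j : ℝ) * m) ^ 2 := by
  have hLr : (1 : ℝ) ≤ L := by exact_mod_cast hL
  have htr : (1 : ℝ) ≤ t := by exact_mod_cast ht
  have hmr : 8 * (t : ℝ) * L ^ 2 ≤ m := by exact_mod_cast hm
  have hm'r : 20 * (t : ℝ) * L ^ 4 * 4 ^ t ≤ m ^ 2 := by exact_mod_cast hm'
  have hLm : 8 * (L : ℝ) ≤ m := by nlinarith [mul_le_mul htr hLr (by simp) (by positivity)]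
  have hmpos : (0 : ℝ) < m := by linarith
  have hjm : ∀ j ∈ Icc 1 t, (m : ℝ) ≤ j * m := fun j hj => by
    have : (1 : ℝ) ≤ j := by exact_mod_cast (mem_Icc.1 hj).1
    nlinarith
  set x : ℕ → ℝ := fun j => if j = 0 then (L : ℝ) else j * m with hx
  have hx0 : x 0 = L := by simp [hx]
  have hxj : ∀ j ∈ Icc 1 t, x j = j * m := fun j hj => by
    have : j ≠ 0 := by have := (mem_Icc.1 hj).1; omega
    simp [hx, this]
  have h0 : 0 ∉ Icc 1 t := by simp
  have hinj : Set.InjOn x (insert 0 (Icc 1 t) : Finset ℕ) := by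
    intro i hi j hj hij
    rcases mem_insert.1 (mem_coe.1 hi) with rfl | hi <;>
      rcases mem_insert.1 (mem_coe.1 hj) with rfl | hj
    · rfl
    · rw [hx0, hxj j hj] at hij; linarith [hjm j hj]
    · rw [hx0, hxj i hi] at hij; linarith [hjm i hi]
    · rw [hxj i hi, hxj j hj] at hij
      exact_mod_cast mul_right_cancel₀ hmpos.ne' hij
  have hdeg : p.degree < #(insert 0 (Icc 1 t)) := by
    rw [card_insert_of_notMem h0, Nat.card_Icc]
    refine lt_of_le_of_lt degree_le_natDegree ?_
    exact_mod_cast (by omega : p.natDegree < t + 1 - 1 + 1)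
  set ℓ : ℕ → ℝ := fun j => (Lagrange.basis (insert 0 (Icc 1 t)) x j).eval 0 with hℓ
  have hformula : p.eval 0 = p.eval (L : ℝ) * ℓ 0 + ∑ j ∈ Icc 1 t, p.eval ((j : ℝ) * m) * ℓ j := by
    conv_lhs => rw [Lagrange.eq_interpolate hinj hdeg]
    rw [Lagrange.interpolate_apply, eval_finsetSum, sum_insert h0]
    simp only [eval_C_mul, hx0]
    congr 1
    exact sum_congr rfl fun j hj => by rw [hxj j hj]
  -- The weight of the node `L` is `∏ (1 - L / (j m))⁻¹`, bounded by Bernoulli's inequality.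
  have hℓ0 : |ℓ 0| ≤ (1 - 1 / (8 * (L : ℝ)))⁻¹ := by
    have hu : 1 - 1 / (8 * (L : ℝ)) ≤ (1 - L / m) ^ t := by
      have hb := one_add_mul_le_pow (a := -(L / m : ℝ))
        (by rw [neg_le_neg_iff, div_le_iff₀ hmpos]; linarith) t
      refine le_trans ?_ (hb.trans_eq (by rw [← sub_eq_add_neg]))
      have : (t : ℝ) * (L / m) ≤ 1 / (8 * L) := by
        rw [mul_div_assoc', div_le_div_iff₀ hmpos (by positivity)]
        nlinarith
      linarith
    have hpos : 0 < 1 - 1 / (8 * (L : ℝ)) := by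
      rw [sub_pos, div_lt_one (by positivity)]; linarith
    have hLm1 : 0 < 1 - (L : ℝ) / m := by rw [sub_pos, div_lt_one hmpos]; linarith
    refine le_trans ?_ (inv_anti₀ hpos hu)
    rw [hℓ]
    simp only
    rw [eval_basis_eq_prod, erase_insert h0, abs_prod, ← inv_pow]
    refine (prod_le_prod (g := fun _ => (1 - (L : ℝ) / m)⁻¹) (fun _ _ => abs_nonneg _)
      fun j hj => ?_).trans_eq (by rw [prod_const, Nat.card_Icc, Nat.add_sub_cancel])
    have h1 := hjm j hj
    rw [hx0, hxj j hj, zero_sub, ← neg_sub, neg_div_neg_eq, abs_of_pos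
      (div_pos (by linarith) (by linarith)), div_le_iff₀ (by linarith), ← div_eq_inv_mul,
      le_div_iff₀ hLm1]
    have : (L : ℝ) ≤ (j * m) * (L / m) := by
      rw [mul_div_assoc', le_div_iff₀ hmpos]
      nlinarith
    linarith
  have hℓj : ∀ j ∈ Icc 1 t, ℓ j ^ 2 ≤ 4 * L ^ 2 * 4 ^ t / m ^ 2 := by
    intro j hj
    have h1 := hjm j hj
    have hj0 : j ≠ 0 := fun h => h0 (h ▸ hj)
    have hℓabs : |ℓ j| = |(L : ℝ) / (j * m - L)| * t.choose j := by
      rw [hℓ]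
      simp only
      rw [eval_basis_eq_prod, erase_insert_of_ne hj0.symm,
        prod_insert (fun h => h0 (mem_of_mem_erase h)), abs_mul, hx0, hxj j hj, zero_sub, neg_div,
        abs_neg, abs_prod, ← prod_abs_div_sub_eq_choose (mem_Icc.1 hj).1 (mem_Icc.1 hj).2]
      congr 1
      refine prod_congr rfl fun i hi => ?_
      rw [hxj i (mem_of_mem_erase hi), zero_sub, neg_div, abs_neg, ← sub_mul,
        mul_div_mul_right _ _ hmpos.ne']
    have hchoose : (t.choose j : ℝ) ≤ 2 ^ t := by exact_mod_cast Nat.choose_le_two_pow t j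
    have hle : |ℓ j| ≤ 2 * L / m * 2 ^ t := by
      rw [hℓabs]
      refine mul_le_mul ?_ hchoose (by positivity) (by positivity)
      rw [abs_of_pos (div_pos (by linarith) (by linarith)), div_le_div_iff₀ (by linarith) hmpos]
      nlinarith
    rw [← sq_abs]
    refine (pow_le_pow_left₀ (abs_nonneg _) hle 2).trans_eq ?_
    rw [mul_pow, div_pow, mul_pow, ← pow_mul, mul_comm t 2, pow_mul]
    norm_num
    ring
  rw [hformula]
  refine sq_add_sum_mul_le (r := 1 / (4 * (L : ℝ))) _ _ _ (by positivity) ?_ ?_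
  · rw [← sq_abs]
    set u : ℝ := 1 / (8 * (L : ℝ)) with hu
    have hu0 : 0 < u := by positivity
    have hu1 : u ≤ 1 / 8 := by
      rw [hu, div_le_div_iff₀ (by positivity) (by norm_num)]; linarith
    have h4 : 1 / (4 * (L : ℝ)) = 2 * u := by rw [hu]; field_simp; norm_num
    have h8 : 1 / (L : ℝ) = 8 * u := by rw [hu]; field_simp
    have h1u : 0 < 1 - u := by linarith
    have hsq : |ℓ 0| ^ 2 ≤ ((1 - u)⁻¹) ^ 2 := pow_le_pow_left₀ (abs_nonneg _) hℓ0 2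
    rw [h4, h8]
    refine (mul_le_mul_of_nonneg_left hsq (by linarith)).trans ?_
    rw [inv_pow, ← div_eq_mul_inv, div_le_iff₀ (by positivity)]
    nlinarith [mul_pos hu0 hu0, mul_pos (mul_pos hu0 hu0) hu0]
  · have hsum : ∑ j ∈ Icc 1 t, ℓ j ^ 2 ≤ t * (4 * L ^ 2 * 4 ^ t / m ^ 2) := by
      refine (sum_le_card_nsmul _ _ _ hℓj).trans_eq ?_
      rw [Nat.card_Icc, Nat.add_sub_cancel, nsmul_eq_mul]
    rw [one_div, inv_inv]
    refine (mul_le_mul_of_nonneg_left hsum (by positivity)).trans ?_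
    have h5 : 1 + 4 * (L : ℝ) ≤ 5 * L := by linarith
    refine (mul_le_mul_of_nonneg_right h5 (by positivity)).trans ?_
    rw [le_div_iff₀ (by positivity)]
    calc 5 * (L : ℝ) * (t * (4 * L ^ 2 * 4 ^ t / m ^ 2)) * L
        = 20 * t * L ^ 4 * 4 ^ t / m ^ 2 := by ring
      _ ≤ 1 := by rw [div_le_one (by positivity)]; exact hm'r

/-! ### The masses of the levels under the symmetric solution -/

/-- The total mass that the symmetric solution puts on the sets of size `k`, for `k > 0`. -/
def levelMass (n t : ℕ) (ε : ℝ) (k : ℕ) : ℝ :=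
  if k = ⌊Real.log n⌋₊ then (1 + ε) * n / (((n : ℝ) - 1) * (⌊Real.log n⌋₊ : ℝ))
  else ∑ j ∈ Finset.Icc 1 t, if k * t = j * n then ε * t / ((j : ℝ) * n) else 0

lemma solutionNonempty_eq (n t : ℕ) (ε : ℝ) (I : Finset (Fin n)) :
    solutionNonempty n t ε I = (n.choose #I : ℝ)⁻¹ * levelMass n t ε #I := rfl

lemma sum_symmetric_mul {n : ℕ} (w f : ℕ → ℝ) :
    ∑ I : Finset (Fin n), (n.choose #I : ℝ)⁻¹ * w #I * f #I = ∑ k ∈ range (n + 1), w k * f k := by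
  rw [sum_univ_eq_sum_levels]
  refine sum_congr rfl fun k hk => ?_
  have hpos : (n.choose k : ℝ) ≠ 0 := by
    exact_mod_cast (Nat.choose_pos (Nat.lt_succ_iff.1 (mem_range.1 hk))).ne'
  rw [sum_congr rfl (g := fun _ => (n.choose k : ℝ)⁻¹ * w k * f k)
    fun I hI => by rw [(mem_powersetCard.1 hI).2]]
  rw [sum_const, card_powersetCard, card_univ, Fintype.card_fin, nsmul_eq_mul]
  field_simp

/-- With `n = m t` and `L < m`, the case distinction defining the masses has disjoint cases. -/
lemma levelMass_eq {n t m : ℕ} (hn : n = m * t) (ht : 1 ≤ t) (hLm : ⌊Real.log n⌋₊ < m) (ε : ℝ)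
    (k : ℕ) :
    levelMass n t ε k =
      (if k = ⌊Real.log n⌋₊ then (1 + ε) * n / (((n : ℝ) - 1) * (⌊Real.log n⌋₊ : ℝ)) else 0)
        + ∑ j ∈ Icc 1 t, if k = j * m then ε / ((j : ℝ) * m) else 0 := by
  have htr : (t : ℝ) ≠ 0 := by exact_mod_cast (by omega : t ≠ 0)
  unfold levelMass
  split_ifs with hk
  · rw [sum_eq_zero, add_zero]
    intro j hj
    rw [if_neg]
    intro h
    have : m ≤ j * m := Nat.le_mul_of_pos_left m (mem_Icc.1 hj).1
    omega
  · rw [zero_add]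
    refine sum_congr rfl fun j _ => ?_
    have hiff : k * t = j * n ↔ k = j * m := by
      rw [hn, ← mul_assoc]
      exact Nat.mul_left_inj (by omega)
    have hval : ε * t / ((j : ℝ) * n) = ε / ((j : ℝ) * m) := by
      rw [hn, Nat.cast_mul, ← mul_assoc, mul_div_mul_right _ _ htr]
    simp only [hiff, hval]

lemma levelMass_nonneg {n t : ℕ} {ε : ℝ} (hε : 0 ≤ ε) (hn : 1 ≤ n) (k : ℕ) :
    0 ≤ levelMass n t ε k := by
  have hnr : (1 : ℝ) ≤ n := by exact_mod_cast hn
  unfold levelMass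
  split_ifs
  · exact div_nonneg (by positivity) (mul_nonneg (by linarith) (by positivity))
  · refine sum_nonneg fun j _ => ?_
    split_ifs <;> positivity

/-- Small levels carry no mass. -/
lemma levelMass_eq_zero {n t m : ℕ} (hn : n = m * t) (ht : 1 ≤ t) (hLm : ⌊Real.log n⌋₊ < m)
    (ε : ℝ) {k : ℕ} (hk : k < ⌊Real.log n⌋₊) : levelMass n t ε k = 0 := by
  rw [levelMass_eq hn ht hLm, if_neg hk.ne, zero_add]
  refine sum_eq_zero fun j hj => if_neg ?_
  have : m ≤ j * m := Nat.le_mul_of_pos_left m (mem_Icc.1 hj).1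
  omega

lemma sum_levelMass_mul {n t m : ℕ} (hn : n = m * t) (ht : 1 ≤ t) (hLm : ⌊Real.log n⌋₊ < m) (ε : ℝ)
    (f : ℕ → ℝ) :
    ∑ k ∈ range (n + 1), levelMass n t ε k * f k =
      (1 + ε) * n / (((n : ℝ) - 1) * (⌊Real.log n⌋₊ : ℝ)) * f ⌊Real.log n⌋₊
        + ∑ j ∈ Icc 1 t, ε / ((j : ℝ) * m) * f (j * m) := by
  have hmn : m ≤ n := hn ▸ Nat.le_mul_of_pos_right m ht
  simp only [levelMass_eq hn ht hLm, add_mul, sum_add_distrib, sum_mul]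
  congr 1
  · simp only [ite_mul, zero_mul, sum_ite_eq']
    rw [if_pos (mem_range.2 (by omega))]
  · rw [sum_comm]
    refine sum_congr rfl fun j hj => ?_
    have : j * m ≤ n := by
      rw [hn, mul_comm m t]
      exact Nat.mul_le_mul_right m (mem_Icc.1 hj).2
    simp only [ite_mul, zero_mul, sum_ite_eq']
    rw [if_pos (mem_range.2 (by omega))]

lemma solutionNonempty_empty {n t m : ℕ} (hn : n = m * t) (ht : 1 ≤ t) (hLm : ⌊Real.log n⌋₊ < m)
    (hL : 0 < ⌊Real.log n⌋₊) (ε : ℝ) : solutionNonempty n t ε ∅ = 0 := by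
  rw [solutionNonempty_eq, card_empty, levelMass_eq_zero hn ht hLm ε hL, mul_zero]

lemma solution_empty {n t m : ℕ} (hn : n = m * t) (ht : 1 ≤ t) (hLm : ⌊Real.log n⌋₊ < m)
    (hL : 0 < ⌊Real.log n⌋₊) (ε : ℝ) :
    solution n t ε ∅ = 1 - ((1 + ε) * n / (((n : ℝ) - 1) * (⌊Real.log n⌋₊ : ℝ))
        + ∑ j ∈ Icc 1 t, ε / ((j : ℝ) * m)) := by
  have h := sum_levelMass_mul hn ht hLm ε (fun _ => 1)
  rw [← sum_symmetric_mul (n := n) (levelMass n t ε) (fun _ => 1)] at h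
  simp only [mul_one] at h
  rw [solution, if_pos rfl, sum_erase _ (solutionNonempty_empty hn ht hLm hL ε), ← h]
  rfl

lemma sum_solution {n t : ℕ} (ε : ℝ) : ∑ I, solution n t ε I = 1 := by
  have h : ∑ I ∈ univ.erase ∅, solution n t ε I = ∑ I ∈ univ.erase ∅, solutionNonempty n t ε I :=
    sum_congr rfl fun I hI => by rw [solution, if_neg (ne_of_mem_erase hI)]
  rw [← add_sum_erase _ _ (mem_univ ∅), h, solution, if_pos rfl, sub_add_cancel]

lemma sum_unitCost_mul_point {n : ℕ} (I : Finset (Fin n)) :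
    ∑ i, unitCost n i * point I i = #I := by
  simp [unitCost, point]

lemma objective_solution {n t m : ℕ} (hn : n = m * t) (ht : 1 ≤ t) (hLm : ⌊Real.log n⌋₊ < m)
    (hL : 0 < ⌊Real.log n⌋₊) (ε : ℝ) :
    objective (unitCost n) (solution n t ε) = (1 + ε) * n / ((n : ℝ) - 1) + t * ε := by
  have hm : (m : ℝ) ≠ 0 := by exact_mod_cast (by omega : m ≠ 0)
  have hLr : (⌊Real.log n⌋₊ : ℝ) ≠ 0 := by exact_mod_cast hL.ne'
  have h := sum_levelMass_mul hn ht hLm ε (fun k => k)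
  rw [← sum_symmetric_mul (n := n) (levelMass n t ε) (fun k => k)] at h
  have hsum : objective (unitCost n) (solution n t ε)
      = ∑ I : Finset (Fin n), (n.choose #I : ℝ)⁻¹ * levelMass n t ε #I * (#I : ℝ) := by
    refine sum_congr rfl fun I _ => ?_
    rw [sum_unitCost_mul_point]
    rcases eq_or_ne I ∅ with rfl | hI
    · simp
    · rw [solution, if_neg hI, solutionNonempty_eq]
  rw [hsum, h]
  congr 1
  · rw [← div_div, div_mul_cancel₀ _ hLr]
  · rw [sum_congr rfl (g := fun _ => ε), sum_const, Nat.card_Icc, Nat.add_sub_cancel, nsmul_eq_mul]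
    intro j hj
    have hj0 : (j : ℝ) ≠ 0 := by exact_mod_cast (by have := (mem_Icc.1 hj).1; omega : j ≠ 0)
    push_cast
    field_simp

/-! ### Feasibility of the symmetric solution -/

/-- Holds because `16 ≤ exp 3`. -/
lemma four_pow_floor_log_sq_le {n : ℕ} (hn : 1 ≤ n) : (4 ^ ⌊Real.log n⌋₊) ^ 2 ≤ n ^ 3 := by
  have hnr : (1 : ℝ) ≤ n := by exact_mod_cast hn
  have h1 : Real.exp 1 ^ ⌊Real.log n⌋₊ ≤ (n : ℝ) := by
    rw [← Real.exp_nat_mul, mul_one]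
    calc Real.exp (⌊Real.log n⌋₊ : ℝ) ≤ Real.exp (Real.log n) :=
          Real.exp_le_exp.2 (Nat.floor_le (Real.log_nonneg hnr))
      _ = n := Real.exp_log (by linarith)
  have h16 : (4 : ℝ) ^ 2 ≤ Real.exp 1 ^ 3 :=
    le_trans (by norm_num) (pow_le_pow_left₀ (by norm_num) Real.exp_one_gt_d9.le 3)
  have h : ((4 : ℝ) ^ ⌊Real.log n⌋₊) ^ 2 ≤ (n : ℝ) ^ 3 := by
    calc ((4 : ℝ) ^ ⌊Real.log n⌋₊) ^ 2 = (4 ^ 2) ^ ⌊Real.log n⌋₊ := by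
          rw [← pow_mul, ← pow_mul, mul_comm]
      _ ≤ (Real.exp 1 ^ 3) ^ ⌊Real.log n⌋₊ := pow_le_pow_left₀ (by norm_num) h16 _
      _ = (Real.exp 1 ^ ⌊Real.log n⌋₊) ^ 3 := by rw [← pow_mul, ← pow_mul, mul_comm]
      _ ≤ (n : ℝ) ^ 3 := pow_le_pow_left₀ (by positivity) h1 3
  exact_mod_cast h

lemma eight_mul_sq_le {n t m L : ℕ} (hn : n = m * t) (ht : 1 ≤ t) (htL : t ≤ L)
    (hbig : 400 * L ^ 14 ≤ n) : 8 * t * L ^ 2 ≤ m := by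
  have hL : 1 ≤ L := ht.trans htL
  refine Nat.le_of_mul_le_mul_right ?_ ht
  calc 8 * t * L ^ 2 * t ≤ 8 * L * L ^ 2 * L := by gcongr
    _ = 8 * L ^ 4 := by ring
    _ ≤ 400 * L ^ 14 := Nat.mul_le_mul (by norm_num) (Nat.pow_le_pow_right hL (by norm_num))
    _ ≤ m * t := hn ▸ hbig

lemma twenty_mul_four_pow_le {n t m : ℕ} (hn : n = m * t) (ht : 1 ≤ t) (htL : t ≤ ⌊Real.log n⌋₊)
    (hbig : 400 * ⌊Real.log n⌋₊ ^ 14 ≤ n) :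
    20 * t * ⌊Real.log n⌋₊ ^ 4 * 4 ^ t ≤ m ^ 2 := by
  set L := ⌊Real.log n⌋₊
  have hL : 1 ≤ L := ht.trans htL
  have hn1 : 1 ≤ n := le_trans (by have := Nat.one_le_pow 14 L hL; omega) hbig
  have h4 : (4 ^ L) ^ 2 ≤ n ^ 3 := four_pow_floor_log_sq_le hn1
  have hmain : 20 * L ^ 7 * 4 ^ L ≤ n ^ 2 := by
    refine (Nat.pow_le_pow_iff_left (n := 2) (by norm_num)).1 ?_
    calc (20 * L ^ 7 * 4 ^ L) ^ 2 = 400 * L ^ 14 * (4 ^ L) ^ 2 := by ring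
      _ ≤ n * n ^ 3 := Nat.mul_le_mul hbig h4
      _ = (n ^ 2) ^ 2 := by ring
  refine Nat.le_of_mul_le_mul_right (c := t ^ 2) ?_ (by positivity)
  calc 20 * t * L ^ 4 * 4 ^ t * t ^ 2 ≤ 20 * L * L ^ 4 * 4 ^ L * L ^ 2 := by gcongr; norm_num
    _ = 20 * L ^ 7 * 4 ^ L := by ring
    _ ≤ n ^ 2 := hmain
    _ = m ^ 2 * t ^ 2 := by rw [hn, mul_pow]

lemma div_sub_one_le_two {n : ℕ} (hn : 2 ≤ n) : (n : ℝ) / (n - 1) ≤ 2 := by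
  have hnr : (2 : ℝ) ≤ n := by exact_mod_cast hn
  rw [div_le_iff₀ (by linarith)]
  linarith

/-- The mass of the nonempty sets is at most `2 (1 + ε) / L + t ε`. -/
lemma abs_solution_empty_sub_one_le {n t m : ℕ} (hn : n = m * t) (ht : 1 ≤ t)
    (hLm : ⌊Real.log n⌋₊ < m) (hL : 0 < ⌊Real.log n⌋₊) (hn2 : 2 ≤ n) {ε : ℝ} (hε : 0 ≤ ε) :
    solution n t ε ∅ ≤ 1 ∧
      1 - solution n t ε ∅ ≤ 2 * (1 + ε) / (⌊Real.log n⌋₊ : ℝ) + t * ε / m := by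
  have hnr : (2 : ℝ) ≤ n := by exact_mod_cast hn2
  have hn1 : (0 : ℝ) < n - 1 := by linarith
  have hmr : (0 : ℝ) < m := by exact_mod_cast (by omega : 0 < m)
  have hLr : (0 : ℝ) < ⌊Real.log n⌋₊ := by exact_mod_cast hL
  rw [solution_empty hn ht hLm hL]
  set L := ⌊Real.log n⌋₊
  have h1 : 0 ≤ (1 + ε) * n / (((n : ℝ) - 1) * L) := by positivity
  have h2 : 0 ≤ ∑ j ∈ Icc 1 t, ε / ((j : ℝ) * m) := sum_nonneg fun j _ => by positivity
  have h3 : (1 + ε) * n / (((n : ℝ) - 1) * L) ≤ 2 * (1 + ε) / L := by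
    rw [← div_div, mul_div_assoc, mul_comm]
    have := div_sub_one_le_two hn2
    gcongr
  have h4 : ∑ j ∈ Icc 1 t, ε / ((j : ℝ) * m) ≤ t * ε / m := by
    refine (sum_le_card_nsmul _ _ (ε / m) fun j hj => ?_).trans_eq ?_
    · have : (1 : ℝ) ≤ j := by exact_mod_cast (mem_Icc.1 hj).1
      gcongr
      nlinarith
    · rw [Nat.card_Icc, Nat.add_sub_cancel, nsmul_eq_mul, mul_div_assoc]
  exact ⟨by linarith, by linarith⟩

/-- The one-dimensional form of the feasibility of the symmetric solution. The left-hand side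
bounds the contribution of the empty set, on which the constraints are violated. The mass
parameter is `4 / L`, so that the level `L`, whose factor is `(1 + 4 / L) (1 - 2 / L)`, outweighs the
coefficient `1 + 1 / L` of `p(L)²` in `sq_eval_zero_le`. -/
lemma sq_eval_zero_le_sum_levels {n t m : ℕ} (hn : n = m * t) (ht : 1 ≤ t)
    (htL : t ≤ ⌊Real.log n⌋₊) (hL : 10 ≤ ⌊Real.log n⌋₊) (hbig : 400 * ⌊Real.log n⌋₊ ^ 14 ≤ n)
    (p : ℝ[X]) (hp : p.natDegree ≤ t) :
    (n : ℝ) / (n - 1) * p.eval 0 ^ 2 ≤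
      ∑ k ∈ range (n + 1),
        levelMass n t (4 / (⌊Real.log n⌋₊ : ℝ)) k * ((k : ℝ) - 2) * p.eval (k : ℝ) ^ 2 := by
  have hm := eight_mul_sq_le hn ht htL hbig
  have hm' := twenty_mul_four_pow_le hn ht htL hbig
  have hLm : ⌊Real.log n⌋₊ < m := by nlinarith
  have hsum := sum_levelMass_mul hn ht hLm (4 / (⌊Real.log n⌋₊ : ℝ))
    (fun k => ((k : ℝ) - 2) * p.eval (k : ℝ) ^ 2)
  simp only [← mul_assoc] at hsum
  rw [hsum]
  have hkey := sq_eval_zero_le ht (by omega) hm hm' p hp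
  set L := ⌊Real.log n⌋₊
  have hLr : (10 : ℝ) ≤ L := by exact_mod_cast hL
  have hmr : (10 : ℝ) ≤ m := by exact_mod_cast (by omega : 10 ≤ m)
  have hn2 : 2 ≤ n := by nlinarith
  have hnr : (2 : ℝ) ≤ n := by exact_mod_cast hn2
  have hr0 : 0 ≤ (n : ℝ) / (n - 1) := div_nonneg (by linarith) (by linarith)
  have hr2 := div_sub_one_le_two hn2
  refine (mul_le_mul_of_nonneg_left hkey hr0).trans ?_
  rw [mul_add, ← mul_assoc, ← mul_assoc]
  refine add_le_add (mul_le_mul_of_nonneg_right ?_ (sq_nonneg _)) ?_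
  · have h1 : 1 + 1 / (L : ℝ) ≤ (1 + 4 / L) * ((L - 2) / L) := by
      have hpos : (0 : ℝ) < L := by linarith
      rw [← sub_nonneg]
      have : (1 + 4 / (L : ℝ)) * ((L - 2) / L) - (1 + 1 / L) = (L - 8) / L ^ 2 := by
        field_simp
        ring
      rw [this]
      exact div_nonneg (by linarith) (by positivity)
    refine (mul_le_mul_of_nonneg_left h1 hr0).trans_eq ?_
    have : (n : ℝ) - 1 ≠ 0 := by linarith
    field_simp
  · rw [mul_sum]
    refine sum_le_sum fun j hj => ?_
    have hj1 : (1 : ℝ) ≤ j := by exact_mod_cast (mem_Icc.1 hj).1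
    have hjm : (10 : ℝ) ≤ j * m := by nlinarith
    push_cast
    refine mul_le_mul_of_nonneg_right ?_ (sq_nonneg _)
    have h1 : (1 : ℝ) / 2 ≤ (j * m - 2) / (j * m) := by
      rw [div_le_div_iff₀ (by norm_num) (by linarith)]
      linarith
    calc (n : ℝ) / (n - 1) * (1 / L) ≤ 2 * (1 / L) :=
          mul_le_mul_of_nonneg_right hr2 (by positivity)
      _ = 4 / L * (1 / 2) := by ring
      _ ≤ 4 / L * ((j * m - 2) / (j * m)) := mul_le_mul_of_nonneg_left h1 (by positivity)
      _ = 4 / L / (j * m) * (j * m - 2) := by ring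

lemma solution_nonneg {n t m : ℕ} (hn : n = m * t) (ht : 1 ≤ t)
    (htL : t ≤ ⌊Real.log n⌋₊) (hL : 10 ≤ ⌊Real.log n⌋₊) (hbig : 400 * ⌊Real.log n⌋₊ ^ 14 ≤ n)
    (I : Finset (Fin n)) : 0 ≤ solution n t (4 / (⌊Real.log n⌋₊ : ℝ)) I := by
  have hm := eight_mul_sq_le hn ht htL hbig
  have hLm : ⌊Real.log n⌋₊ < m := by nlinarith
  have hn2 : 2 ≤ n := by nlinarith
  rcases eq_or_ne I ∅ with rfl | hI
  · have h := (abs_solution_empty_sub_one_le hn ht hLm (by omega) hn2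
      (ε := 4 / (⌊Real.log n⌋₊ : ℝ)) (by positivity)).2
    have htm : t ≤ m := by omega
    set L := ⌊Real.log n⌋₊
    have hLr : (10 : ℝ) ≤ L := by exact_mod_cast hL
    have htmr : (t : ℝ) ≤ m := by exact_mod_cast htm
    have hmr : (0 : ℝ) < m := by exact_mod_cast (by omega : 0 < m)
    have h1 : 4 / (L : ℝ) ≤ 4 / 10 := by gcongr
    have h2 : 2 * (1 + 4 / (L : ℝ)) / L ≤ 2 * (1 + 4 / 10) / 10 := by gcongr
    have h3 : t * (4 / (L : ℝ)) / m ≤ 4 / 10 := by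
      rw [div_le_iff₀ hmr]
      have : (0 : ℝ) ≤ t := by positivity
      nlinarith
    linarith
  · rw [solution, if_neg hI, solutionNonempty_eq]
    exact mul_nonneg (by positivity) (levelMass_nonneg (by positivity) (by omega) _)

/-- The localizing matrix of a constraint that is violated by at most `1 + 1 / (n - 1)` on the empty
set and has value at least `|I| - 2` on every set `I` is positive semidefinite: the mass of the higher levels
outweighs that of the empty set. -/
lemma posSemidef_localizing {n t m : ℕ} (hn : n = m * t) (ht : 1 ≤ t)
    (htL : t ≤ ⌊Real.log n⌋₊) (hL : 10 ≤ ⌊Real.log n⌋₊) (hbig : 400 * ⌊Real.log n⌋₊ ^ 14 ≤ n)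
    (h : Finset (Fin n) → ℝ) (h0 : -((n : ℝ) / (n - 1)) ≤ h ∅)
    (h1 : ∀ I, (#I : ℝ) - 2 ≤ h I) :
    (zetaMatrix t fun I => h I * solution n t (4 / (⌊Real.log n⌋₊ : ℝ)) I).PosSemidef := by
  rw [posSemidef_zetaMatrix_iff]
  intro v
  have hm := eight_mul_sq_le hn ht htL hbig
  have hLm : ⌊Real.log n⌋₊ < m := by nlinarith
  have hn2 : 2 ≤ n := by nlinarith
  have hnr : (2 : ℝ) ≤ n := by exact_mod_cast hn2
  have hr0 : 0 ≤ (n : ℝ) / (n - 1) := div_nonneg (by linarith) (by linarith)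
  set ε : ℝ := 4 / (⌊Real.log n⌋₊ : ℝ) with hε
  have hε0 : 0 ≤ ε := by positivity
  have hy0 : 0 ≤ solution n t ε ∅ := solution_nonneg hn ht htL hL hbig ∅
  have hy1 : solution n t ε ∅ ≤ 1 :=
    (abs_solution_empty_sub_one_le hn ht hLm (by omega) hn2 hε0).1
  have hkey := sq_eval_zero_le_sum_levels hn ht htL hL hbig (levelAverage v)
    (natDegree_levelAverage_le v)
  rw [← hε, eval_zero_levelAverage] at hkey
  have havg := sum_levels_mul_sq_le (n := n) v (w := fun k => levelMass n t ε k * ((k : ℝ) - 2))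
    (fun k => by
      rcases lt_or_ge k ⌊Real.log n⌋₊ with hk | hk
      · rw [levelMass_eq_zero hn ht hLm ε hk, zero_mul]
      · have : (2 : ℝ) ≤ k := by exact_mod_cast (by omega : 2 ≤ k)
        exact mul_nonneg (levelMass_nonneg hε0 (by omega) k) (by linarith))
  have hempty : (n : ℝ) / (n - 1) * solution n t ε ∅ * (v ⬝ᵥ zeta t ∅) ^ 2
      ≤ n / (n - 1) * (v ⬝ᵥ zeta t ∅) ^ 2 :=
    mul_le_mul_of_nonneg_right (mul_le_of_le_one_right hr0 hy1) (sq_nonneg _)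
  have hterm0 : -((n : ℝ) / (n - 1) * solution n t ε ∅ * (v ⬝ᵥ zeta t ∅) ^ 2)
      ≤ h ∅ * solution n t ε ∅ * (v ⬝ᵥ zeta t ∅) ^ 2 := by
    rw [← neg_mul, ← neg_mul]
    exact mul_le_mul_of_nonneg_right (mul_le_mul_of_nonneg_right h0 hy0) (sq_nonneg _)
  have hrest : ∑ I : Finset (Fin n), (n.choose #I : ℝ)⁻¹ * (levelMass n t ε #I * ((#I : ℝ) - 2))
        * (v ⬝ᵥ zeta t I) ^ 2
      ≤ ∑ I ∈ univ.erase ∅, h I * solution n t ε I * (v ⬝ᵥ zeta t I) ^ 2 := by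
    rw [← sum_erase (s := univ) (a := ∅)
      (f := fun I : Finset (Fin n) => (n.choose #I : ℝ)⁻¹ * (levelMass n t ε #I * ((#I : ℝ) - 2))
        * (v ⬝ᵥ zeta t I) ^ 2)]
    · refine sum_le_sum fun I hI => mul_le_mul_of_nonneg_right ?_ (sq_nonneg _)
      have hy : 0 ≤ solution n t ε I := solution_nonneg hn ht htL hL hbig I
      refine le_trans (le_of_eq ?_) (mul_le_mul_of_nonneg_right (h1 I) hy)
      rw [solution, if_neg (ne_of_mem_erase hI), solutionNonempty_eq]
      ring
    · rw [card_empty, levelMass_eq_zero hn ht hLm ε (by omega : 0 < _)]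
      ring
  rw [← add_sum_erase _ _ (mem_univ (∅ : Finset (Fin n)))]
  linarith

lemma eval_demand {n : ℕ} (I : Finset (Fin n)) :
    (lpPlus n .demand).eval (point I) = #I - (1 + 1 / ((n : ℝ) - 1)) := by
  simp [lpPlus, LinConstraint.eval, point]

lemma eval_cover {n : ℕ} (A : Finset (Fin n)) (hA : #A = n - 1) (I : Finset (Fin n)) :
    (lpPlus n (.cover A hA)).eval (point I) = (#(A ∩ I) : ℝ) - 1 := by
  simp [lpPlus, LinConstraint.eval, point, ← ite_and, ← mem_inter, inter_comm A]

lemma eval_nonneg {n : ℕ} (i : Fin n) (I : Finset (Fin n)) :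
    0 ≤ (lpPlus n (.nonneg i)).eval (point I) := by
  simp only [lpPlus, LinConstraint.eval, point, ite_mul, one_mul, zero_mul, sum_ite_eq', mem_univ,
    if_true, sub_zero]
  split_ifs <;> norm_num

lemma eval_le_one {n : ℕ} (i : Fin n) (I : Finset (Fin n)) :
    0 ≤ (lpPlus n (.le_one i)).eval (point I) := by
  simp only [lpPlus, LinConstraint.eval, point, ite_mul, zero_mul, sum_ite_eq', mem_univ, if_true]
  split_ifs <;> norm_num

lemma card_le_card_inter_add_one {n : ℕ} {A : Finset (Fin n)} (hA : #A = n - 1)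
    (I : Finset (Fin n)) : #I ≤ #(A ∩ I) + 1 := by
  have h1 := card_union_add_card_inter A I
  have h2 : #(A ∪ I) ≤ n := (card_le_univ _).trans_eq (Fintype.card_fin n)
  omega

theorem solution_mem_SoS {n t m : ℕ} (hn : n = m * t) (ht : 1 ≤ t)
    (htL : t ≤ ⌊Real.log n⌋₊) (hL : 10 ≤ ⌊Real.log n⌋₊) (hbig : 400 * ⌊Real.log n⌋₊ ^ 14 ≤ n) :
    solution n t (4 / (⌊Real.log n⌋₊ : ℝ)) ∈ SoS t (lpPlus n) := by
  have hn2 : 2 ≤ n := by nlinarith [Nat.one_le_pow 14 ⌊Real.log n⌋₊ (by omega)]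
  have hnr : (2 : ℝ) ≤ n := by exact_mod_cast hn2
  have hr : (n : ℝ) / (n - 1) = 1 + 1 / ((n : ℝ) - 1) := by
    have : (n : ℝ) - 1 ≠ 0 := by linarith
    field_simp
    ring
  have hr1 : 0 ≤ 1 / ((n : ℝ) - 1) := one_div_nonneg.2 (by linarith)
  have hr2 := div_sub_one_le_two hn2
  refine ⟨sum_solution _, posSemidef_zetaMatrix_of_nonneg _
    (solution_nonneg hn ht htL hL hbig), ?_⟩
  rintro (_ | ⟨A, hA⟩ | i | i)
  · refine posSemidef_localizing hn ht htL hL hbig _ ?_ fun I => ?_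
    · simp only [eval_demand, card_empty, Nat.cast_zero]
      linarith
    · simp only [eval_demand]
      linarith
  · refine posSemidef_localizing hn ht htL hL hbig _ ?_ fun I => ?_
    · simp only [eval_cover, inter_empty, card_empty, Nat.cast_zero]
      linarith
    · have : (#I : ℝ) ≤ #(A ∩ I) + 1 := by exact_mod_cast card_le_card_inter_add_one hA I
      simp only [eval_cover]
      linarith
  · exact posSemidef_zetaMatrix_of_nonneg _ fun I =>
      mul_nonneg (eval_nonneg i I) (solution_nonneg hn ht htL hL hbig I)
  · exact posSemidef_zetaMatrix_of_nonneg _ fun I =>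
      mul_nonneg (eval_le_one i I) (solution_nonneg hn ht htL hL hbig I)

/-! ### The integral optimum and the value of the relaxation -/

lemma isLeast_integralValues {n : ℕ} (hn : 2 ≤ n) :
    IsLeast (integralValues (unitCost n) (lpPlus n)) 2 := by
  have hnr : (2 : ℝ) ≤ n := by exact_mod_cast hn
  constructor
  · obtain ⟨I, -, hI⟩ := exists_subset_card_eq (s := (univ : Finset (Fin n))) (n := 2)
      (by rwa [card_univ, Fintype.card_fin])
    refine ⟨I, ?_, by rw [sum_unitCost_mul_point, hI, Nat.cast_ofNat]⟩
    rintro (_ | ⟨A, hA⟩ | i | i)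
    · have : 1 / ((n : ℝ) - 1) ≤ 1 := by rw [div_le_one (by linarith)]; linarith
      rw [eval_demand, hI]
      push_cast
      linarith
    · have h := card_le_card_inter_add_one hA I
      have h' : (1 : ℝ) ≤ #(A ∩ I) := by exact_mod_cast (by omega : 1 ≤ #(A ∩ I))
      rw [eval_cover]
      linarith
    · exact eval_nonneg i I
    · exact eval_le_one i I
  · rintro _ ⟨I, hI, rfl⟩
    have h := hI .demand
    have hpos : 0 < 1 / ((n : ℝ) - 1) := one_div_pos.2 (by linarith)
    rw [eval_demand] at h
    have h1 : (1 : ℝ) < #I := by linarith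
    rw [sum_unitCost_mul_point]
    exact_mod_cast h1

/-- The demand constraint is inherited by the relaxation. -/
lemma one_le_objective {n t : ℕ} (hn : 2 ≤ n) {y : Finset (Fin n) → ℝ} (hy : y ∈ SoS t (lpPlus n)) :
    1 ≤ objective (unitCost n) y := by
  have hnr : (2 : ℝ) ≤ n := by exact_mod_cast hn
  have hpos : 0 < 1 / ((n : ℝ) - 1) := one_div_pos.2 (by linarith)
  have h := sum_nonneg_of_posSemidef_zetaMatrix (hy.2.2 .demand)
  simp only [eval_demand, sub_mul, sum_sub_distrib, ← mul_sum] at h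
  rw [hy.1] at h
  simp only [objective, sum_unitCost_mul_point, mul_comm (y _)]
  linarith

lemma isGLB_sInf_objective {n t : ℕ} (hn : 2 ≤ n) (hne : (SoS t (lpPlus n)).Nonempty) :
    IsGLB (objective (unitCost n) '' SoS t (lpPlus n))
      (sInf (objective (unitCost n) '' SoS t (lpPlus n))) := by
  refine isGLB_csInf (hne.image _) ⟨1, ?_⟩
  rintro _ ⟨y, hy, rfl⟩
  exact one_le_objective hn hy

/-! ### Asymptotics of the parameters -/

lemma tendsto_log_natCast : Tendsto (fun n : ℕ => Real.log n) atTop atTop :=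
  Real.tendsto_log_atTop.comp tendsto_natCast_atTop_atTop

lemma items_eq (δ : ℝ) (k : ℕ) : items δ k = k / rounds δ k * rounds δ k := rfl

lemma rounds_le_rpow (δ : ℝ) (k : ℕ) : (rounds δ k : ℝ) ≤ Real.log k ^ (1 - δ) :=
  Nat.floor_le (Real.rpow_nonneg (Real.log_natCast_nonneg k) _)

lemma eventually_one_le_rounds {δ : ℝ} (hδ1 : δ ≤ 1) : ∀ᶠ k : ℕ in atTop, 1 ≤ rounds δ k := by
  filter_upwards [tendsto_log_natCast.eventually_ge_atTop 1] with k hk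
  rw [rounds, Nat.one_le_floor_iff]
  exact Real.one_le_rpow hk (by linarith)

/-- Rounding down to a multiple of the number of rounds loses at most half of the items. -/
lemma eventually_half_le_items {δ : ℝ} (hδ : 0 < δ) (hδ1 : δ ≤ 1) :
    ∀ᶠ k : ℕ in atTop, (k : ℝ) / 2 ≤ items δ k := by
  have hlog : ∀ᶠ k : ℕ in atTop, Real.log k ≤ 1 / 2 * k := by
    have h := (Real.isLittleO_log_id_atTop.comp_tendsto
      (tendsto_natCast_atTop_atTop (R := ℝ))).bound (by norm_num : (0 : ℝ) < 1 / 2)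
    filter_upwards [h] with k hk
    simp only [Function.comp_apply, id_eq, Real.norm_eq_abs, Nat.abs_cast] at hk
    exact (le_abs_self _).trans hk
  filter_upwards [hlog, tendsto_log_natCast.eventually_ge_atTop 1, eventually_one_le_rounds hδ1]
    with k hk hk1 hpos
  have hr : (rounds δ k : ℝ) ≤ Real.log k :=
    (rounds_le_rpow δ k).trans
      ((Real.rpow_le_rpow_of_exponent_le hk1 (by linarith)).trans_eq (Real.rpow_one _))
  have hle : k ≤ items δ k + rounds δ k := by
    have h1 := Nat.div_add_mod' k (rounds δ k)
    have h2 := Nat.mod_lt k hpos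
    rw [items]
    omega
  have hle' : (k : ℝ) ≤ items δ k + rounds δ k := by exact_mod_cast hle
  linarith

lemma tendsto_items {δ : ℝ} (hδ : 0 < δ) (hδ1 : δ ≤ 1) : Tendsto (items δ) atTop atTop := by
  refine tendsto_natCast_atTop_iff.1 (tendsto_atTop_mono' _ (eventually_half_le_items hδ hδ1) ?_)
  exact tendsto_natCast_atTop_atTop.atTop_div_const (by norm_num)

lemma tendsto_floor_log_items {δ : ℝ} (hδ : 0 < δ) (hδ1 : δ ≤ 1) :
    Tendsto (fun k => ⌊Real.log (items δ k)⌋₊) atTop atTop :=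
  tendsto_nat_floor_atTop.comp (tendsto_log_natCast.comp (tendsto_items hδ hδ1))

lemma eventually_half_log_le_floor {δ : ℝ} (hδ : 0 < δ) (hδ1 : δ ≤ 1) :
    ∀ᶠ k : ℕ in atTop, Real.log k / 2 ≤ (⌊Real.log (items δ k)⌋₊ : ℝ) := by
  filter_upwards [eventually_half_le_items hδ hδ1, tendsto_log_natCast.eventually_ge_atTop 4,
    eventually_gt_atTop 0] with k hk hk4 hk0
  have hk0' : (0 : ℝ) < k := by exact_mod_cast hk0
  have h1 : Real.log k - Real.log 2 ≤ Real.log (items δ k) := by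
    rw [← Real.log_div hk0'.ne' (by norm_num)]
    exact Real.log_le_log (by positivity) hk
  have h2 := Nat.lt_floor_add_one (Real.log (items δ k))
  have h3 := Real.log_two_lt_d9
  linarith

lemma tendsto_rounds_div_floor_log {δ : ℝ} (hδ : 0 < δ) (hδ1 : δ ≤ 1) :
    Tendsto (fun k => (rounds δ k : ℝ) / (⌊Real.log (items δ k)⌋₊ : ℝ)) atTop (𝓝 0) := by
  have hlim : Tendsto (fun k : ℕ => 2 * Real.log k ^ (-δ)) atTop (𝓝 0) := by
    simpa using ((tendsto_rpow_neg_atTop hδ).comp tendsto_log_natCast).const_mul 2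
  refine squeeze_zero' (Eventually.of_forall fun k => by positivity) ?_ hlim
  filter_upwards [eventually_half_log_le_floor hδ hδ1,
    tendsto_log_natCast.eventually_ge_atTop 1] with k hk hk1
  have hpos : 0 < Real.log k := by linarith
  refine (div_le_div₀ (by positivity) (rounds_le_rpow δ k) (by positivity) hk).trans_eq ?_
  rw [sub_eq_add_neg, Real.rpow_add hpos, Real.rpow_one]
  field_simp

lemma eventually_pow_floor_log_le :
    ∀ᶠ n : ℕ in atTop, 400 * ⌊Real.log n⌋₊ ^ 14 ≤ n := by
  have h := (Real.isLittleO_pow_log_id_atTop (n := 14)).comp_tendsto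
      (tendsto_natCast_atTop_atTop (R := ℝ)) |>.bound (by norm_num : (0 : ℝ) < 1 / 400)
  filter_upwards [h] with n hn
  simp only [Function.comp_apply, id_eq, Real.norm_eq_abs, Nat.abs_cast] at hn
  have h1 : (⌊Real.log n⌋₊ : ℝ) ^ 14 ≤ Real.log n ^ 14 :=
    pow_le_pow_left₀ (by positivity) (Nat.floor_le (Real.log_natCast_nonneg n)) 14
  have h2 : (400 : ℝ) * (⌊Real.log n⌋₊ : ℝ) ^ 14 ≤ n := by
    linarith [le_abs_self (Real.log n ^ 14)]
  exact_mod_cast h2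

/-- All the inequalities between the parameters that feasibility needs. -/
lemma eventually_parameters {δ : ℝ} (hδ : 0 < δ) (hδ1 : δ ≤ 1) :
    ∀ᶠ k : ℕ in atTop, 1 ≤ rounds δ k ∧ rounds δ k ≤ ⌊Real.log (items δ k)⌋₊ ∧
      10 ≤ ⌊Real.log (items δ k)⌋₊ ∧ 400 * ⌊Real.log (items δ k)⌋₊ ^ 14 ≤ items δ k := by
  filter_upwards [eventually_one_le_rounds hδ1,
    (tendsto_floor_log_items hδ hδ1).eventually_ge_atTop 10,
    (tendsto_items hδ hδ1).eventually eventually_pow_floor_log_le,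
    (tendsto_rounds_div_floor_log hδ hδ1).eventually_le_const one_pos] with k h1 h2 h3 h4
  refine ⟨h1, ?_, h2, h3⟩
  rw [div_le_one (by exact_mod_cast (by omega : 0 < ⌊Real.log (items δ k)⌋₊))] at h4
  exact_mod_cast h4

lemma tendsto_objective {δ : ℝ} (hδ : 0 < δ) (hδ1 : δ ≤ 1) :
    Tendsto (fun k => objective (unitCost (items δ k))
      (solution (items δ k) (rounds δ k) (4 / (⌊Real.log (items δ k)⌋₊ : ℝ)))) atTop (𝓝 1) := by
  have hLr := tendsto_natCast_atTop_atTop (R := ℝ).comp (tendsto_floor_log_items hδ hδ1)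
  have hε : Tendsto (fun k => 4 / (⌊Real.log (items δ k)⌋₊ : ℝ)) atTop (𝓝 0) :=
    hLr.const_div_atTop 4
  have hn : Tendsto (fun k => (items δ k : ℝ) - 1) atTop atTop :=
    tendsto_atTop_add_const_right _ _
      ((tendsto_natCast_atTop_atTop (R := ℝ)).comp (tendsto_items hδ hδ1))
  have hlim := (((hε.const_add 1).mul ((hn.const_div_atTop 1).const_add 1)).add
    ((tendsto_rounds_div_floor_log hδ hδ1).const_mul 4))
  norm_num only at hlim
  refine hlim.congr' ?_
  filter_upwards [eventually_parameters hδ hδ1, hn.eventually_gt_atTop 0] with k hk hk1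
  obtain ⟨h1, h2, h3, h4⟩ := hk
  have hm := eight_mul_sq_le (items_eq δ k) h1 h2 h4
  rw [objective_solution (items_eq δ k) h1 (by nlinarith) (by omega)]
  field_simp
  ring

lemma tendsto_solution_empty {δ : ℝ} (hδ : 0 < δ) (hδ1 : δ ≤ 1) :
    Tendsto (fun k => solution (items δ k) (rounds δ k) (4 / (⌊Real.log (items δ k)⌋₊ : ℝ)) ∅)
      atTop (𝓝 1) := by
  have hLr := tendsto_natCast_atTop_atTop (R := ℝ).comp (tendsto_floor_log_items hδ hδ1)
  have hε : Tendsto (fun k => 4 / (⌊Real.log (items δ k)⌋₊ : ℝ)) atTop (𝓝 0) :=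
    hLr.const_div_atTop 4
  have hlim := (((hε.const_add 1).mul (hLr.const_div_atTop 2)).add
    ((tendsto_rounds_div_floor_log hδ hδ1).const_mul 4)).const_sub 1
  norm_num only at hlim
  have hbound : ∀ᶠ k : ℕ in atTop,
      1 - ((1 + 4 / (⌊Real.log (items δ k)⌋₊ : ℝ)) * (2 / (⌊Real.log (items δ k)⌋₊ : ℝ))
          + 4 * ((rounds δ k : ℝ) / (⌊Real.log (items δ k)⌋₊ : ℝ)))
        ≤ solution (items δ k) (rounds δ k) (4 / (⌊Real.log (items δ k)⌋₊ : ℝ)) ∅ ∧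
      solution (items δ k) (rounds δ k) (4 / (⌊Real.log (items δ k)⌋₊ : ℝ)) ∅ ≤ 1 := by
    filter_upwards [eventually_parameters hδ hδ1] with k hk
    obtain ⟨h1, h2, h3, h4⟩ := hk
    have hm := eight_mul_sq_le (items_eq δ k) h1 h2 h4
    have h := abs_solution_empty_sub_one_le (items_eq δ k) h1 (by nlinarith) (by omega)
      (by nlinarith [Nat.one_le_pow 14 ⌊Real.log (items δ k)⌋₊ (by omega)])
      (ε := 4 / (⌊Real.log (items δ k)⌋₊ : ℝ)) (by positivity)
    refine ⟨?_, h.1⟩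
    have hm1 : (1 : ℝ) ≤ (k / rounds δ k : ℕ) := by exact_mod_cast (by nlinarith)
    have hdiv := div_le_self (a := rounds δ k * (4 / (⌊Real.log (items δ k)⌋₊ : ℝ)))
      (by positivity) hm1
    have h5 : (1 + 4 / (⌊Real.log (items δ k)⌋₊ : ℝ)) * (2 / (⌊Real.log (items δ k)⌋₊ : ℝ))
        = 2 * (1 + 4 / (⌊Real.log (items δ k)⌋₊ : ℝ)) / (⌊Real.log (items δ k)⌋₊ : ℝ) := by ring
    have h6 : 4 * ((rounds δ k : ℝ) / (⌊Real.log (items δ k)⌋₊ : ℝ))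
        = rounds δ k * (4 / (⌊Real.log (items δ k)⌋₊ : ℝ)) := by ring
    linarith [h.2]
  exact tendsto_of_tendsto_of_tendsto_of_le_of_le' hlim tendsto_const_nhds
    (hbound.mono fun _ h => h.1) (hbound.mono fun _ h => h.2)

end SoSKnapsack

end

open SoSKnapsack in
theorem theorem3 (δ : ℝ) (hδ : 0 < δ) (hδ1 : δ ≤ 1) :
    ∃ ε : ℕ → ℝ,
      (∀ᶠ n' : ℕ in atTop, 0 < ε n') ∧
      (ε =o[atTop] fun n' : ℕ => ((SoSKnapsack.rounds δ n' : ℕ) : ℝ)⁻¹) ∧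
      (∀ᶠ n' : ℕ in atTop,
        SoSKnapsack.solution (SoSKnapsack.items δ n') (SoSKnapsack.rounds δ n') (ε n') ∈
          SoSKnapsack.SoS (SoSKnapsack.rounds δ n')
            (SoSKnapsack.lpPlus (SoSKnapsack.items δ n'))) ∧
      Tendsto (fun n' : ℕ =>
        SoSKnapsack.solution (SoSKnapsack.items δ n') (SoSKnapsack.rounds δ n') (ε n') ∅)
        atTop (𝓝 1) ∧
      Tendsto (fun n' : ℕ =>
        SoSKnapsack.objective (SoSKnapsack.unitCost (SoSKnapsack.items δ n'))
          (SoSKnapsack.solution (SoSKnapsack.items δ n') (SoSKnapsack.rounds δ n') (ε n')))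
        atTop (𝓝 1) ∧
      (∀ᶠ n' : ℕ in atTop,
        IsLeast (SoSKnapsack.integralValues (SoSKnapsack.unitCost (SoSKnapsack.items δ n'))
          (SoSKnapsack.lpPlus (SoSKnapsack.items δ n'))) 2) ∧
      ∃ ρ : ℕ → ℝ,
        (∀ᶠ n' : ℕ in atTop,
          SoSKnapsack.IsIntegralityGap (SoSKnapsack.rounds δ n')
            (SoSKnapsack.unitCost (SoSKnapsack.items δ n'))
            (SoSKnapsack.lpPlus (SoSKnapsack.items δ n')) (ρ n')) ∧
        Tendsto ρ atTop (𝓝 2) := by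
  have hparam := eventually_parameters hδ hδ1
  have hn2 := (tendsto_items hδ hδ1).eventually_ge_atTop 2
  have hmem : ∀ᶠ k : ℕ in atTop,
      solution (items δ k) (rounds δ k) (4 / (⌊Real.log (items δ k)⌋₊ : ℝ)) ∈
        SoS (rounds δ k) (lpPlus (items δ k)) := by
    filter_upwards [hparam] with k ⟨h1, h2, h3, h4⟩
    exact solution_mem_SoS (items_eq δ k) h1 h2 h3 h4
  refine ⟨fun k => 4 / (⌊Real.log (items δ k)⌋₊ : ℝ), ?_, ?_, hmem, tendsto_solution_empty hδ hδ1,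
    tendsto_objective hδ hδ1, hn2.mono fun _ h => isLeast_integralValues h,
    fun k => 2 / sInf (objective (unitCost (items δ k)) '' SoS (rounds δ k) (lpPlus (items δ k))),
    ?_, ?_⟩
  · filter_upwards [hparam] with k ⟨_, _, h3, _⟩
    have : (0 : ℝ) < ⌊Real.log (items δ k)⌋₊ := by exact_mod_cast (by omega)
    positivity
  · rw [isLittleO_iff_tendsto']
    · have h := (tendsto_rounds_div_floor_log hδ hδ1).const_mul 4
      rw [mul_zero] at h
      refine h.congr fun k => ?_
      rw [div_inv_eq_mul]
      ring
    · filter_upwards [hparam] with k ⟨h1, _, _, _⟩ h0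
      rw [inv_eq_zero, Nat.cast_eq_zero] at h0
      omega
  · filter_upwards [hn2, hmem] with k h2 hk
    have hGLB := isGLB_sInf_objective h2 ⟨_, hk⟩
    refine ⟨2, _, isLeast_integralValues h2, hGLB, one_pos.trans_le (hGLB.2 ?_), rfl⟩
    rintro _ ⟨y, hy, rfl⟩
    exact one_le_objective h2 hy
  -- The value of the relaxation lies between `1` and the objective of the symmetric solution.
  · have hval : Tendsto (fun k => sInf (objective (unitCost (items δ k)) ''
        SoS (rounds δ k) (lpPlus (items δ k)))) atTop (𝓝 1) := by
      refine tendsto_of_tendsto_of_tendsto_of_le_of_le' tendsto_const_nhds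
        (tendsto_objective hδ hδ1) ?_ ?_
      · filter_upwards [hn2, hmem] with k h2 hk
        refine (isGLB_sInf_objective h2 ⟨_, hk⟩).2 ?_
        rintro _ ⟨y, hy, rfl⟩
        exact one_le_objective h2 hy
      · filter_upwards [hn2, hmem] with k h2 hk
        exact (isGLB_sInf_objective h2 ⟨_, hk⟩).1 ⟨_, hk, rfl⟩
    have h := (tendsto_const_nhds (x := (2 : ℝ))).div hval one_ne_zero
    rw [div_one] at h
    exact h
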